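/- Let $J$ be a finite set with $m=|J|\ge 1$ and let $\mathcal P=(J,h)$ be a uniform integer polymatroid: $h:2^J\to\mathbb N_0$ satisfies $h(\emptyset)=0$, is monotone increasing and submodular, and $h(X)=h_{|X|}$ depends only on $|X|$. Put $g_i=h_{i+1}-h_i$ for $0\le i<m$ and $g_m=0$, and let $\eta(g)=\min\{i\in\{0,\dots,m\}: g_i=0\}$. Let $\Pi=(P_x)_{x\in J}$ be a partition of a finite set $P$ of participants into nonempty blocks with $h(\{x\})\le |P_x|$ for all $x\in J$, and for $A\subseteq P$ let $\pi(A)=(|A\cap P_x|)_{x\in J}$. For $X\subseteq J$ let $\mathcal B(\mathcal P,X)$ be the set of all $v\in\mathbb N_0^J$ with $v_x=0$ for $x\notin X$, $\sum_{x\in J} v_x=h(X)$ and $\sum_{y\in Y}v_y\le h(Y)$ for all $Y\subseteq X$. For a family $\Delta\subseteq 2^J$ let $\Gamma(\Pi,\mathcal P,\Delta)$ be the family of all $A\subseteq P$ such that $\pi(A)\ge u$ coordinatewise for some minimal element $u$ of $\bigcup_{X\in\Delta}\mathcal B(\mathcal P,X)$. Suppose that $\eta(g)=m$ (equivalently, $g_{m-1}>0$)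 and that $\Delta\subsetneq 2^J$ is a monotone increasing family with exactly one minimal set. Then: (a) $\Delta$ is compatible with $\mathcal P$, that is, $\emptyset\notin\Delta$ and, for $x_0\notin J$, the function $h'$ on the subsets of $J\cup\{x_0\}$ given for $X\subseteq J$ by $h'(X)=h(X)$, by $h'(X\cup\{x_0\})=h(X)$ if $X\in\Delta$, and by $h'(X\cup\{x_0\})=h(X)+1$ if $X\notin\Delta$, is monotone increasing and submodular; (b) $\Gamma(\Pi,\mathcal P,\Delta)$ is an ideal access structure. That is, it is monotone increasing, contains $P$ but not $\emptyset$, and there is a secret sharing scheme (a finite set $S_0$ of at least two secrets, finite sets $S_p$ of possible shares for $p\in P$, and a randomized map on a finite probability space that assigns to each secret a tuple of shares, where each element of $S_p$ occurs as a share of $p$ with positive probability for some secret) such that $|S_p|=|S_0|$ for all $p\in P$, the shares of the participants in $A$ determine the secret if and only if $A\in\Gamma(\Pi,\mathcal P,\Delta)$, and for $A\notin\Gamma(\Pi,\mathcal P,\Delta)$ the joint distribution of the shares of the participants in $A$ is the same for all secrets. -/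

import Mathlib

namespace SecretSharing

/-! ### Secret sharing schemes -/

/-- A secret sharing scheme on a set `P` of participants. Given a secret `s`, the dealer draws
`r` with law `law` and hands the share `share s r p` to each participant `p`.
There are at least two secrets, and `Share p` is the set of values which the share of `p`
can really take. -/
structure Scheme (P : Type*) where
  Secret : Type
  Share : P → Type
  Rand : Type
  finite_secret : Finite Secret
  finite_share : ∀ p, Finite (Share p)
  finite_rand : Finite Rand
  nontrivial_secret : Nontrivial Secret
  law : PMF Rand
  share : Secret → Rand → ∀ p, Share p
  share_possible : ∀ p (t : Share p), ∃ s, ∃ r ∈ law.support, share s r p = t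

namespace Scheme

variable {P : Type*} (S : Scheme P)

/-- The joint shares of the participants in `A`. -/
def jointShare (A : Finset P) (s : S.Secret) (r : S.Rand) : ∀ p : A, S.Share p :=
  fun p => S.share s r p

/-- The participants in `A` can compute the secret from their shares. -/
def CanRecover (A : Finset P) : Prop :=
  ∃ rec : (∀ p : A, S.Share p) → S.Secret,
    ∀ s, ∀ r ∈ S.law.support, rec (S.jointShare A s r) = s

/-- The shares of the participants in `A` carry no information about the secret: their joint
distribution is the same for all secrets. -/
def NoInformation (A : Finset P) : Prop :=
  ∀ s s' : S.Secret, S.law.map (S.jointShare A s) = S.law.map (S.jointShare A s')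

/-- The family of the authorized sets of a scheme. -/
def accessStructure : Set (Finset P) :=
  {A | S.CanRecover A}

/-- Unauthorized sets get no information about the secret. -/
def IsPerfect : Prop :=
  ∀ A, A ∉ S.accessStructure → S.NoInformation A

/-- A perfect scheme all of whose share sets have the size of the set of secrets. -/
def IsIdeal : Prop :=
  S.IsPerfect ∧ ∀ p, Nat.card (S.Share p) = Nat.card S.Secret

end Scheme

/-- Monotone increasing families that contain the set of all participants but not the
empty set. -/
def IsAccessStructure {P : Type*} [Fintype P] (Γ : Set (Finset P)) : Prop :=
  IsUpperSet Γ ∧ ∅ ∉ Γ ∧ Finset.univ ∈ Γ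

/-- An ideal access structure: the access structure of an ideal secret sharing scheme. -/
def IsIdealAccessStructure {P : Type*} [Fintype P] (Γ : Set (Finset P)) : Prop :=
  IsAccessStructure Γ ∧ ∃ S : Scheme P, S.IsIdeal ∧ S.accessStructure = Γ

/-! ### Partitions of the set of participants -/

/-- A partition of `P` into nonempty blocks indexed by `J`. -/
structure Partition (P J : Type*) where
  block : J → Finset P
  nonempty : ∀ x, (block x).Nonempty
  disjoint : ∀ x y, x ≠ y → Disjoint (block x) (block y)
  cover : ∀ p, ∃ x, p ∈ block x

/-- The vector `(|A ∩ P_x|)_{x ∈ J}`. -/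
def Partition.vec {P J : Type*} [DecidableEq P] (B : Partition P J) (A : Finset P) : J → ℕ :=
  fun x => (A ∩ B.block x).card

/-! ### Integer polymatroids -/

/-- An integer polymatroid with ground set `J`. -/
structure Polymatroid (J : Type*) [DecidableEq J] where
  rank : Finset J → ℕ
  rank_empty : rank ∅ = 0
  rank_mono : ∀ X Y, X ⊆ Y → rank X ≤ rank Y
  rank_submodular : ∀ X Y, rank (X ∩ Y) + rank (X ∪ Y) ≤ rank X + rank Y

namespace Polymatroid

variable {J : Type*} [DecidableEq J] (Q : Polymatroid J)

/-- The rank of a set depends only on its cardinality. -/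
def IsUniform : Prop :=
  ∀ X Y : Finset J, X.card = Y.card → Q.rank X = Q.rank Y

/-- For a uniform polymatroid and `i ≤ |J|`, the common rank `h_i` of the `i`-element sets
(see `levelRank_card`). -/
def levelRank [Fintype J] (i : ℕ) : ℕ :=
  (Finset.univ.powersetCard i).sup Q.rank

/-- The increment sequence: `g_i = h_{i+1} - h_i` for `i < m = |J|`, and `g_m = 0`.
The subtraction is never truncated for a uniform polymatroid (see `rank_add_increment`). -/
def increment [Fintype J] (i : ℕ) : ℕ :=
  if i < Fintype.card J then Q.levelRank (i + 1) - Q.levelRank i else 0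

/-- `η(g) = min {i ∈ {0, …, m} : g_i = 0}`; the set contains `m`. -/
noncomputable def eta [Fintype J] : ℕ :=
  sInf {i | i ≤ Fintype.card J ∧ Q.increment i = 0}

theorem levelRank_card [Fintype J] (hQ : Q.IsUniform) (X : Finset J) :
    Q.levelRank X.card = Q.rank X := by
  apply le_antisymm
  · exact Finset.sup_le fun Y hY => (hQ Y X (Finset.mem_powersetCard.1 hY).2).le
  · exact Finset.le_sup (f := Q.rank)
      (Finset.mem_powersetCard.2 ⟨Finset.subset_univ X, rfl⟩)

theorem rank_add_increment [Fintype J] (hQ : Q.IsUniform) (X : Finset J) (x : J) (hx : x ∉ X) :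
    Q.rank X + Q.increment X.card = Q.rank (insert x X) := by
  have hlt : X.card < Fintype.card J := by
    have := Finset.card_le_univ (insert x X)
    rw [Finset.card_insert_of_notMem hx] at this
    omega
  have h1 := Q.levelRank_card hQ (insert x X)
  rw [Finset.card_insert_of_notMem hx] at h1
  have h2 := Q.rank_mono X (insert x X) (Finset.subset_insert x X)
  rw [increment, if_pos hlt, h1, Q.levelRank_card hQ X]
  omega

open Classical in
/-- The rank function on `J ∪ {x₀}` of the simple extension of `Q` induced by `Δ`.
Here `Option J` is `J ∪ {x₀}`, with `x₀ = none`. -/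
noncomputable def extensionRank (Δ : Set (Finset J)) (Z : Finset (Option J)) : ℕ :=
  if none ∈ Z ∧ Finset.eraseNone Z ∉ Δ then Q.rank (Finset.eraseNone Z) + 1
  else Q.rank (Finset.eraseNone Z)

/-- `Δ` is a monotone increasing family of nonempty sets for which the rank function of the
simple extension is monotone increasing and submodular. -/
def IsCompatible (Δ : Set (Finset J)) : Prop :=
  IsUpperSet Δ ∧ ∅ ∉ Δ ∧
  (∀ Z W, Z ⊆ W → Q.extensionRank Δ Z ≤ Q.extensionRank Δ W) ∧
  ∀ Z W, Q.extensionRank Δ (Z ∩ W) + Q.extensionRank Δ (Z ∪ W) ≤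
    Q.extensionRank Δ Z + Q.extensionRank Δ W

/-- The set `𝓑(Q, X)` of all `v ∈ ℕ^J` with support in `X`, modulus `h(X)`, and
`|v_Y| ≤ h(Y)` for all `Y ⊆ X`. -/
def bases [Fintype J] (X : Finset J) : Set (J → ℕ) :=
  {v | (∀ x, v x ≠ 0 → x ∈ X) ∧ ∑ x, v x = Q.rank X ∧ ∀ Y ⊆ X, ∑ y ∈ Y, v y ≤ Q.rank Y}

end Polymatroid

/-! ### The access structure determined by a polymatroid and a monotone family -/

/-- The minimal members of a family. -/
def minimals {α : Type*} [LE α] (F : Set α) : Set α :=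
  {a | Minimal (· ∈ F) a}

section

variable {P J : Type*} [Fintype P] [DecidableEq P] [Fintype J] [DecidableEq J]

/-- The smallest monotone increasing family of vectors `v ≤ π(P)` that contains
`min ⋃_{X ∈ Δ} 𝓑(Q, X)`. -/
def vectorStructure (B : Partition P J) (Q : Polymatroid J) (Δ : Set (Finset J)) :
    Set (J → ℕ) :=
  {v | v ≤ B.vec Finset.univ ∧ ∃ u ∈ minimals (⋃ X ∈ Δ, Q.bases X), u ≤ v}

/-- The access structure `Γ(Π, Q, Δ)` on the set of participants. -/
def determinedStructure (B : Partition P J) (Q : Polymatroid J) (Δ : Set (Finset J)) :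
    Set (Finset P) :=
  {A | B.vec A ∈ vectorStructure B Q Δ}

end

end SecretSharing

/-! A monotone `Δ` with one minimal set `X₀` is `{X | X₀ ⊆ X}`, and `X₀ ≠ ∅` since `Δ` is proper. As
`η(g) = m`, `h` is strictly increasing, so entering `Δ` gains at least the unit lost at `x₀`; this
gives monotonicity in (a). Submodularity holds because `X₀ ⊆ X` and `X₀ ⊆ Y` force `X₀ ⊆ X ∩ Y`.

For (b), `g` is nonincreasing, and its conjugate partition `c` gives `h(X) = ∑ k, min |X| (c k)`.
Over a large finite field, a direct sum of uniform matroids thus represents `h` by subspaces `W x`.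
Since `g_{m-1} > 0`, one summand is free; there let `e` be the sum of the basis vectors indexed by
`X₀`, so that `e` lies in the span of the `W x`, `x ∈ X`, iff `X₀ ⊆ X` (`exists_representation`).

Give each participant of `P_x` a generic vector of `W x`. The resulting rank formula
(`exists_generic_vectors`) shows that `A` is authorized iff its vectors span `e`
(`mem_determinedStructure_iff_mem_span`). The linear scheme of these vectors is ideal. -/

namespace SecretSharing

open Module Submodule

/-! ### Vectors in general position over a large finite field. -/

section GenericVectors

variable {K V : Type*} [Field K] [AddCommGroup V] [Module K V]

/-- Fewer than `|K|` subspaces, none of which contains `W`, do not cover `W`. -/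
theorem exists_mem_forall_notMem_of_card_lt [Finite K] [FiniteDimensional K V]
    (W : Submodule K V) (s : Finset (Submodule K V)) (hs : s.card < Nat.card K)
    (h : ∀ U ∈ s, ¬ W ≤ U) : ∃ w ∈ W, ∀ U ∈ s, w ∉ U := by
  classical
  have : Finite V := Module.finite_of_finite K
  by_contra! hcov
  have hq : 1 < Nat.card K := Finite.one_lt_card
  have hsub : (W : Set V) ⊆ ⋃ U ∈ s, ((W ⊓ U : Submodule K V) : Set V) := by
    intro w hw
    obtain ⟨U, hU, hwU⟩ := hcov w hw
    exact Set.mem_iUnion₂.2 ⟨U, hU, hw, hwU⟩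
  have hcard : ∀ U ∈ s, ((W ⊓ U : Submodule K V) : Set V).ncard ≤
      Nat.card K ^ (finrank K W - 1) := by
    intro U hU
    have hlt : finrank K (W ⊓ U : Submodule K V) < finrank K W :=
      Submodule.finrank_lt_finrank_of_lt
        (lt_of_le_of_ne inf_le_left fun he => h U hU (inf_eq_left.1 he))
    have he : ((W ⊓ U : Submodule K V) : Set V).ncard =
        Nat.card K ^ finrank K (W ⊓ U : Submodule K V) :=
      Module.natCard_eq_pow_finrank (K := K) (V := (W ⊓ U : Submodule K V))
    rw [he]
    exact Nat.pow_le_pow_right hq.le (by omega)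
  have hW : (W : Set V).ncard = Nat.card K ^ finrank K W :=
    Module.natCard_eq_pow_finrank (K := K) (V := W)
  have hle : Nat.card K ^ finrank K W ≤ s.card * Nat.card K ^ (finrank K W - 1) := by
    rw [← hW]
    calc (W : Set V).ncard ≤ (⋃ U ∈ s, ((W ⊓ U : Submodule K V) : Set V)).ncard :=
          Set.ncard_le_ncard hsub (Set.toFinite _)
      _ ≤ ∑ U ∈ s, ((W ⊓ U : Submodule K V) : Set V).ncard :=
          Finset.set_ncard_biUnion_le s _
      _ ≤ s.card * Nat.card K ^ (finrank K W - 1) := by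
          rw [← smul_eq_mul]
          exact Finset.sum_le_card_nsmul s _ _ hcard
  -- The count needs `finrank K W - 1` untruncated. If `W = ⊥`, no `U` can fail to contain it, so
  -- `s` is empty and covers nothing.
  rcases Nat.eq_zero_or_pos (finrank K W) with h0 | h0
  · have hbot : W = ⊥ := Submodule.finrank_eq_zero.1 h0
    have : s = ∅ := Finset.eq_empty_of_forall_notMem fun U hU => h U hU (hbot ▸ bot_le)
    obtain ⟨U, hU, -⟩ := hcov 0 W.zero_mem
    simp [this] at hU
  · obtain ⟨d, hd⟩ := Nat.exists_eq_succ_of_ne_zero h0.ne'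
    rw [hd, Nat.succ_sub_one, Nat.pow_succ, mul_comm] at hle
    exact absurd (Nat.le_of_mul_le_mul_right hle (pow_pos (by omega) d)) (by omega)

/-- Generic vectors `v p` in the subspaces `W (f p)`, with the rank formula for the spans of sets
of these vectors and of these subspaces. The inequality `≤` holds for every `C ⊆ A`. -/
theorem exists_generic_vectors [Finite K] [FiniteDimensional K V]
    {P ι : Type*} [Fintype P] [DecidableEq P] [Fintype ι] [DecidableEq ι]
    (hK : 2 ^ (Fintype.card P + Fintype.card ι) < Nat.card K)
    (W : ι → Submodule K V) (f : P → ι) :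
    ∃ v : P → V, (∀ p, v p ∈ W (f p)) ∧ ∀ (A : Finset P) (Y : Finset ι), ∃ C ⊆ A,
      finrank K (span K (v '' A) ⊔ Y.sup W : Submodule K V) =
        (A \ C).card + finrank K ((Y ∪ C.image f).sup W : Submodule K V) := by
  classical
  -- Vectors are placed one at a time. `Y` stays arbitrary because the induction step enlarges it.
  suffices H : ∀ S : Finset P, ∃ v : P → V, (∀ p ∈ S, v p ∈ W (f p)) ∧
      ∀ A ⊆ S, ∀ Y : Finset ι, ∃ C ⊆ A,
      finrank K (span K (v '' A) ⊔ Y.sup W : Submodule K V) =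
        (A \ C).card + finrank K ((Y ∪ C.image f).sup W : Submodule K V) by
    obtain ⟨v, hv, hr⟩ := H Finset.univ
    exact ⟨v, fun p => hv p (Finset.mem_univ p), fun A => hr A (Finset.subset_univ A)⟩
  intro S
  induction S using Finset.induction_on with
  | empty =>
    refine ⟨0, by simp, fun A hA Y => ⟨∅, Finset.empty_subset _, ?_⟩⟩
    obtain rfl := Finset.subset_empty.1 hA
    rw [Finset.coe_empty, Set.image_empty, span_empty, bot_sup_eq, Finset.image_empty,
      Finset.union_empty, Finset.sdiff_self, Finset.card_empty, zero_add]
  | insert p S hp ih =>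
    obtain ⟨v, hv, hr⟩ := ih
    let F : Finset P × Finset ι → Submodule K V := fun a => span K (v '' a.1) ⊔ a.2.sup W
    let s : Finset (Submodule K V) := (Finset.univ.image F).filter fun U => ¬ W (f p) ≤ U
    have hs : s.card < Nat.card K := by
      refine lt_of_le_of_lt ((Finset.card_filter_le _ _).trans Finset.card_image_le) ?_
      simpa [Finset.card_univ, Fintype.card_prod, pow_add] using hK
    obtain ⟨w, hw, hws⟩ := exists_mem_forall_notMem_of_card_lt (W (f p)) s hs
      fun U hU => (Finset.mem_filter.1 hU).2
    have hupd : ∀ A : Finset P, p ∉ A → (Function.update v p w) '' A = v '' A := by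
      intro A hA
      refine Set.image_congr fun q hq => Function.update_of_ne ?_ _ _
      rintro rfl
      exact hA hq
    refine ⟨Function.update v p w, ?_, fun A hA Y => ?_⟩
    · intro q hq
      by_cases hqp : q = p
      · subst hqp
        simpa using hw
      · rw [Function.update_of_ne hqp]
        exact hv q (Finset.mem_of_mem_insert_of_ne hq hqp)
    · by_cases hpA : p ∈ A
      · obtain ⟨A, hpA', rfl⟩ : ∃ A' : Finset P, p ∉ A' ∧ A = insert p A' :=
          ⟨A.erase p, by simp, (Finset.insert_erase hpA).symm⟩
        have hAS : A ⊆ S := fun q hq =>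
          Finset.mem_of_mem_insert_of_ne (hA (Finset.mem_insert_of_mem hq))
            fun h => hpA' (h ▸ hq)
        have hspan : span K (Function.update v p w '' (insert p A : Finset P)) ⊔ Y.sup W =
            F (A, Y) ⊔ span K {w} := by
          rw [Finset.coe_insert, Set.image_insert_eq, hupd A hpA', Function.update_self,
            span_insert, sup_assoc, sup_comm]
        rw [hspan]
        -- If `F (A, Y)` contains `W (f p)`, adding `w` has the same effect as adding `f p` to `Y`,
        -- so `p` joins `C`. Otherwise `w` avoids `F (A, Y)`, the dimension grows by one, and `p` is
        -- counted in `A \ C`.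
        by_cases hle : W (f p) ≤ F (A, Y)
        · have h1 : F (A, Y) ⊔ span K {w} = span K (v '' A) ⊔ (insert (f p) Y).sup W := by
            have h2 : span K {w} ≤ F (A, Y) := (span_singleton_le_iff_mem w _).2 (hle hw)
            rw [sup_eq_left.2 h2, Finset.sup_insert, sup_left_comm]
            exact (sup_eq_right.2 hle).symm
          obtain ⟨C, hC, hCr⟩ := hr A hAS (insert (f p) Y)
          refine ⟨insert p C, Finset.insert_subset_insert p hC, ?_⟩
          rw [h1, hCr, Finset.insert_sdiff_insert, Finset.sdiff_insert_of_notMem hpA',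
            Finset.image_insert, Finset.insert_union, Finset.union_insert]
        · have hwF : w ∉ F (A, Y) := hws _ (Finset.mem_filter.2
            ⟨Finset.mem_image_of_mem F (Finset.mem_univ _), hle⟩)
          obtain ⟨C, hC, hCr⟩ := hr A hAS Y
          refine ⟨C, hC.trans (Finset.subset_insert p A), ?_⟩
          rw [finrank_sup_span_singleton hwF, hCr,
            Finset.insert_sdiff_of_notMem _ fun h => hpA' (hC h),
            Finset.card_insert_of_notMem fun h => hpA' (Finset.mem_sdiff.1 h).1]
          omega
      · rw [hupd A hpA]
        exact hr A (fun q hq => Finset.mem_of_mem_insert_of_ne (hA hq) fun h => hpA (h ▸ hq)) Y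

/-- A representation of the uniform matroid of rank `min c |J|`. -/
theorem exists_uniform_vectors [Finite K] {J : Type*} [Fintype J] [DecidableEq J]
    (hK : 2 ^ (Fintype.card J + 1) < Nat.card K) (c : ℕ) :
    ∃ w : J → Fin c → K, ∀ X : Finset J, finrank K (span K (w '' X)) = min X.card c := by
  -- All vectors are generic in one space `K^c`: the formula yields `|X|` for `C = ∅` and at least
  -- `c` for `C ≠ ∅`.
  obtain ⟨w, -, hw⟩ := exists_generic_vectors (K := K) (V := Fin c → K) (P := J) (ι := Unit)
    (by simpa using hK) (fun _ => ⊤) (fun _ => ())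
  refine ⟨w, fun X => ?_⟩
  have hle : finrank K (span K (w '' X)) ≤ c := by
    simpa using Submodule.finrank_le (span K (w '' (X : Set J)))
  have hle' : finrank K (span K (w '' X)) ≤ X.card := by
    classical
    rw [← Finset.coe_image]
    exact (finrank_span_finset_le_card _).trans Finset.card_image_le
  obtain ⟨C, hC, hr⟩ := hw X ∅
  rw [Finset.sup_empty, sup_bot_eq] at hr
  rcases C.eq_empty_or_nonempty with rfl | hne
  · simp at hr
    omega
  · have : finrank K ((∅ ∪ C.image fun _ => ()).sup fun _ => (⊤ : Submodule K (Fin c → K)) :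
        Submodule K (Fin c → K)) = c := by
      rw [Finset.empty_union, Finset.sup_const (hne.image _), finrank_top]
      simp
    omega

end GenericVectors

/-! ### Products of subspaces. -/

section Pi

variable {K ι : Type*} [Field K] {E : ι → Type*} [∀ i, AddCommGroup (E i)] [∀ i, Module K (E i)]

theorem pi_sup_pi (p q : ∀ i, Submodule K (E i)) :
    Submodule.pi Set.univ p ⊔ Submodule.pi Set.univ q = Submodule.pi Set.univ (p ⊔ q) := by
  apply le_antisymm
  · exact sup_le (Submodule.pi_mono fun i _ => le_sup_left)
      (Submodule.pi_mono fun i _ => le_sup_right)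
  · intro x hx
    choose y hy z hz hyz using fun i => Submodule.mem_sup.1 (hx i (Set.mem_univ i))
    exact Submodule.mem_sup.2 ⟨y, fun i _ => hy i, z, fun i _ => hz i, funext hyz⟩

theorem sup_pi_span_singleton {J : Type*} [DecidableEq J] (w : ∀ i, J → E i) (X : Finset J) :
    (X.sup fun x => Submodule.pi Set.univ fun i => span K {w i x}) =
      Submodule.pi Set.univ fun i => span K (w i '' X) := by
  induction X using Finset.induction_on with
  | empty => simp
  | insert x X _ ih =>
    rw [Finset.sup_insert, ih, pi_sup_pi]
    congr 1
    funext i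
    rw [Finset.coe_insert, Set.image_insert_eq, span_insert]
    rfl

theorem finrank_pi_submodule [Fintype ι] [∀ i, FiniteDimensional K (E i)]
    (p : ∀ i, Submodule K (E i)) :
    finrank K (Submodule.pi Set.univ p) = ∑ i, finrank K (p i) := by
  let e : Submodule.pi Set.univ p ≃ₗ[K] ∀ i, p i :=
    { toFun := fun x i => ⟨x.1 i, x.2 i (Set.mem_univ i)⟩
      invFun := fun y => ⟨fun i => y i, fun i _ => (y i).2⟩
      map_add' := fun _ _ => rfl
      map_smul' := fun _ _ => rfl
      left_inv := fun _ => rfl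
      right_inv := fun _ => rfl }
  rw [e.finrank_eq, Module.finrank_pi_fintype]

end Pi


/-! ### Linear secret sharing schemes. -/

section LinearScheme

variable {K V : Type} [Field K] [AddCommGroup V] [Module K V]

/-- The linear functional with value `s` at `e` that differs from `r` by a multiple of `φ`,
where `φ e = 1`. -/
def adjust (φ : Dual K V) (e : V) (s : K) (r : Dual K V) : Dual K V :=
  r + (s - r e) • φ

theorem adjust_apply_self {φ : Dual K V} {e : V} (hφ : φ e = 1) (s : K) (r : Dual K V) :
    adjust φ e s r e = s := by
  simp [adjust, hφ]

theorem adjust_self (φ : Dual K V) (e : V) (r : Dual K V) : adjust φ e (r e) r = r := by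
  simp [adjust]

/-- If `ψ` vanishes on the vectors of `A`, translating the randomness by `(s' - s) • ψ` changes the
secret but no share of `A`. -/
theorem adjust_add_smul {φ ψ : Dual K V} {e : V} (hψ : ψ e = 1) (s s' : K) (r : Dual K V) :
    adjust φ e s' (r + (s' - s) • ψ) = adjust φ e s r + (s' - s) • ψ := by
  ext x
  simp [adjust, hψ]
  ring

theorem exists_dual_apply_eq {x : V} (hx : x ≠ 0) (t : K) : ∃ ψ : Dual K V, ψ x = t := by
  obtain ⟨ψ, -, hψ⟩ := LinearMap.exists_extend_of_notMem
    (0 : (⊥ : Submodule K V) →ₗ[K] K) (by simpa using hx) t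
  exact ⟨ψ, hψ⟩

variable [Finite K] [FiniteDimensional K V] {P : Type*}

/-- The linear scheme given by the vectors `v p`: for the secret `s`, the participants get the
values at their vectors of a random functional with value `s` at `e`. -/
noncomputable def linearScheme (φ : Dual K V) (e : V) (v : P → V) (hv : ∀ p, v p ≠ 0) :
    Scheme P where
  Secret := K
  Share _ := K
  Rand := Dual K V
  finite_secret := inferInstance
  finite_share _ := inferInstance
  finite_rand := Module.finite_of_finite K
  nontrivial_secret := inferInstance
  law := @PMF.uniformOfFintype _ (@Fintype.ofFinite _ (Module.finite_of_finite K)) _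
  share s r p := adjust φ e s r (v p)
  share_possible p t := by
    obtain ⟨ψ, hψ⟩ := exists_dual_apply_eq (hv p) t
    -- With secret `ψ e` no adjustment occurs, so the share is `ψ (v p) = t`.
    refine ⟨ψ e, ψ, ?_, ?_⟩
    · rw [PMF.support_uniformOfFintype]
      trivial
    · rw [adjust_self, hψ]

theorem map_uniformOfFintype {α : Type*} [Fintype α] [Nonempty α] (σ : α ≃ α) :
    (PMF.uniformOfFintype α).map σ = PMF.uniformOfFintype α := by
  ext a
  rw [PMF.map_apply, tsum_eq_single (σ.symm a)]
  · simp
  · intro b hb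
    rw [if_neg]
    rintro rfl
    simp at hb

/-- The combination expressing `e` in the vectors of `A`, applied to the shares, gives the secret.
-/
theorem linearScheme_canRecover {φ : Dual K V} {e : V} (hφ : φ e = 1) {v : P → V}
    (hv : ∀ p, v p ≠ 0) {A : Finset P} (he : e ∈ span K (v '' A)) :
    (linearScheme φ e v hv).CanRecover A := by
  classical
  obtain ⟨c, hc⟩ := (Submodule.mem_span_image_finset_iff_exists_fun K).1 he
  let recover : (A → K) → K := fun t => ∑ p : A, c p * t p
  have h : ∀ (s : K) (r : Dual K V), recover (fun p : A => adjust φ e s r (v p)) = s := by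
    intro s r
    have h' := adjust_apply_self hφ s r
    generalize adjust φ e s r = ψ at h' ⊢
    rw [← h', ← hc]
    simp [recover]
  exact ⟨recover, fun s r _ => h s r⟩

theorem linearScheme_noInformation {φ : Dual K V} {e : V} {v : P → V}
    (hv : ∀ p, v p ≠ 0) {A : Finset P} (he : e ∉ span K (v '' A)) :
    (linearScheme φ e v hv).NoInformation A := by
  obtain ⟨ψ, hψA, hψ⟩ := LinearMap.exists_extend_of_notMem
    (0 : span K (v '' A) →ₗ[K] K) he 1
  have hψ0 : ∀ p ∈ A, ψ (v p) = 0 := fun p hp =>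
    LinearMap.congr_fun hψA ⟨v p, subset_span ⟨p, hp, rfl⟩⟩
  let S := linearScheme φ e v hv
  suffices H : ∀ s s' : K, S.law.map (S.jointShare A s) = S.law.map (S.jointShare A s') from H
  intro s s'
  let σ : S.Rand ≃ S.Rand := Equiv.addRight (G := Dual K V) ((s' - s) • ψ)
  have hσ : S.jointShare A s = S.jointShare A s' ∘ σ := by
    funext r p
    have h := LinearMap.congr_fun (adjust_add_smul (φ := φ) hψ s s' r) (v p)
    rw [LinearMap.add_apply, LinearMap.smul_apply, hψ0 p p.2, smul_zero, add_zero] at h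
    exact h.symm
  have hlaw : S.law.map σ = S.law :=
    @map_uniformOfFintype (Dual K V) (@Fintype.ofFinite _ (Module.finite_of_finite K)) _ σ
  calc S.law.map (S.jointShare A s) = S.law.map (S.jointShare A s' ∘ σ) := by rw [hσ]
    _ = (S.law.map σ).map (S.jointShare A s') := (PMF.map_comp _ _ _).symm
    _ = S.law.map (S.jointShare A s') := by rw [hlaw]

theorem Scheme.not_canRecover_of_noInformation (S : Scheme P) {A : Finset P}
    (h : S.NoInformation A) : ¬ S.CanRecover A := by
  rintro ⟨rec, hrec⟩
  obtain ⟨s, s', hs⟩ := S.nontrivial_secret.exists_pair_ne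
  obtain ⟨r, hr⟩ := S.law.support_nonempty
  have hmem : S.jointShare A s r ∈ (S.law.map (S.jointShare A s)).support :=
    (PMF.mem_support_map_iff _ _ _).2 ⟨r, hr, rfl⟩
  rw [h s s'] at hmem
  obtain ⟨r', hr', he⟩ := (PMF.mem_support_map_iff _ _ _).1 hmem
  exact hs (by rw [← hrec s r hr, ← he, hrec s' r' hr'])

theorem exists_ideal_scheme_of_vectors {e : V} (he : e ≠ 0) (v : P → V) (hv : ∀ p, v p ≠ 0) :
    ∃ S : Scheme P, S.IsIdeal ∧ S.accessStructure = {A : Finset P | e ∈ span K (v '' A)} := by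
  obtain ⟨φ, hφ⟩ := exists_dual_apply_eq he (1 : K)
  have hacc : (linearScheme φ e v hv).accessStructure = {A : Finset P | e ∈ span K (v '' A)} := by
    ext A
    refine ⟨fun hA => ?_, linearScheme_canRecover hφ hv⟩
    by_contra hn
    exact Scheme.not_canRecover_of_noInformation _ (linearScheme_noInformation hv hn) hA
  refine ⟨linearScheme φ e v hv, ⟨fun A hA => ?_, fun p => rfl⟩, hacc⟩
  rw [hacc] at hA
  exact linearScheme_noInformation hv hA

end LinearScheme


/-! ### Uniform polymatroids: decomposition, representation, compatibility. -/

namespace Polymatroid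

variable {J : Type*} [Fintype J] [DecidableEq J] {Q : Polymatroid J}

theorem increment_pos (hη : Q.eta = Fintype.card J) {i : ℕ} (hi : i < Fintype.card J) :
    0 < Q.increment i := by
  by_contra h
  have h1 : Q.eta ≤ i := Nat.sInf_le ⟨hi.le, by omega⟩
  omega

/-- Submodularity for `X ∪ {x}` and `X ∪ {y}`; from index `m` on, increments are 0 by definition. -/
theorem increment_antitone (hQ : Q.IsUniform) : Antitone Q.increment := by
  refine antitone_nat_of_succ_le fun i => ?_
  by_cases hi : i + 1 < Fintype.card J
  · obtain ⟨Z, -, hZ⟩ := Finset.exists_subset_card_eq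
      (s := (Finset.univ : Finset J)) (n := i + 2) (by rw [Finset.card_univ]; omega)
    obtain ⟨x, Z, hx, rfl, hZ'⟩ := Finset.card_eq_succ.1 hZ
    obtain ⟨y, X, hy, rfl, hX⟩ := Finset.card_eq_succ.1 hZ'
    rw [Finset.mem_insert, not_or] at hx
    have h1 := Q.rank_add_increment hQ X x hx.2
    have h2 := Q.rank_add_increment hQ X y hy
    have h3 := Q.rank_add_increment hQ (insert y X) x (by simpa using hx)
    have h4 := Q.rank_submodular (insert x X) (insert y X)
    have h5 : insert x X ∩ insert y X = X := by
      ext z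
      simp only [Finset.mem_inter, Finset.mem_insert]
      constructor
      · rintro ⟨rfl | h, rfl | h'⟩
        · exact absurd rfl hx.1
        all_goals assumption
      · exact fun h => ⟨.inr h, .inr h⟩
    have h6 : insert x X ∪ insert y X = insert x (insert y X) := by
      ext z
      simp only [Finset.mem_union, Finset.mem_insert]
      tauto
    rw [h5, h6] at h4
    rw [hZ'] at h3
    rw [hX] at h1 h2
    omega
  · rw [increment, if_neg hi]
    exact Nat.zero_le _

theorem rank_eq_sum_increment (hQ : Q.IsUniform) (X : Finset J) :
    Q.rank X = ∑ i ∈ Finset.range X.card, Q.increment i := by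
  induction X using Finset.induction_on with
  | empty => simp [Q.rank_empty]
  | insert x X hx ih =>
    rw [Finset.card_insert_of_notMem hx, Finset.sum_range_succ, ← ih,
      Q.rank_add_increment hQ X x hx]

theorem rank_lt_rank (hQ : Q.IsUniform) (hη : Q.eta = Fintype.card J) {X Y : Finset J}
    (h : X ⊂ Y) : Q.rank X < Q.rank Y := by
  obtain ⟨y, hy, hsub⟩ := Finset.ssubset_iff.1 h
  have h1 := Q.rank_add_increment hQ X y hy
  have h2 := increment_pos hη (Finset.card_lt_univ_of_notMem hy)
  have h3 := Q.rank_mono _ _ hsub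
  omega

/-- A uniform polymatroid is a sum of rank functions of uniform matroids, one of which is free
if `η(g) = |J|`. -/
theorem exists_rank_eq_sum_min [Nonempty J] (hQ : Q.IsUniform) (hη : Q.eta = Fintype.card J) :
    ∃ (n : ℕ) (c : Fin n → ℕ), (∀ X : Finset J, Q.rank X = ∑ k, min X.card (c k)) ∧
      ∃ k, c k = Fintype.card J := by
  have hanti := increment_antitone hQ
  have hm : Q.increment (Fintype.card J) = 0 := by simp [increment]
  have hex : ∀ k, ∃ i, Q.increment i ≤ k := fun k => ⟨_, hm.le.trans (Nat.zero_le k)⟩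
  have hlt : ∀ i k, i < Nat.find (hex k) ↔ k < Q.increment i := by
    intro i k
    rw [Nat.lt_find_iff]
    exact ⟨fun h => not_le.1 (h i le_rfl),
      fun h j hj => not_le.2 (h.trans_le (hanti hj))⟩
  -- By antitonicity, `c k` counts the `i` with `g_i > k`. The rank formula double counts the pairs
  -- `i < |X|`, `k < g_i`; positivity of `g` below `m` gives `c 0 = m`.
  refine ⟨Q.increment 0, fun k => Nat.find (hex k), fun X => ?_,
    ⟨0, increment_pos hη Fintype.card_pos⟩, ?_⟩
  · have h1 : ∀ k, min X.card (Nat.find (hex k)) =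
        ∑ i ∈ Finset.range X.card, if k < Q.increment i then 1 else 0 := by
      intro k
      rw [← Finset.card_filter]
      simp_rw [← hlt]
      rw [← Finset.card_range (min X.card (Nat.find (hex k)))]
      congr 1
      ext i
      simp
    simp_rw [h1]
    rw [rank_eq_sum_increment hQ, Finset.sum_comm]
    refine Finset.sum_congr rfl fun i _ => ?_
    rw [Fin.sum_univ_eq_sum_range (fun k => if k < Q.increment i then 1 else 0) (Q.increment 0),
      ← Finset.card_filter]
    conv_lhs => rw [← Finset.card_range (Q.increment i)]
    congr 1
    ext k
    have := hanti (Nat.zero_le i)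
    simp
    omega
  · apply le_antisymm
    · exact Nat.find_min' _ hm.le
    · by_contra! h
      have h1 := increment_pos hη h
      have h2 := (hlt (Nat.find (hex 0)) 0).2 h1
      exact absurd h2 (lt_irrefl _)

/-- A linear representation of the simple extension of a uniform polymatroid by an element `e`
for the family of all sets that contain `X₀`. -/
theorem exists_representation [Nonempty J] (hQ : Q.IsUniform) (hη : Q.eta = Fintype.card J)
    (X₀ : Finset J) {K : Type} [Field K] [Finite K]
    (hK : 2 ^ (Fintype.card J + 1) < Nat.card K) :
    ∃ (n : ℕ) (c : Fin n → ℕ) (W : J → Submodule K (∀ k, Fin (c k) → K))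
      (e : ∀ k, Fin (c k) → K), (∀ X : Finset J, finrank K (X.sup W : Submodule K _) = Q.rank X) ∧
      ∀ X : Finset J, e ∈ X.sup W ↔ X₀ ⊆ X := by
  classical
  obtain ⟨n, c, hc, k₀, hk₀⟩ := exists_rank_eq_sum_min hQ hη
  choose w hw using fun k => exists_uniform_vectors (K := K) (J := J) hK (c k)
  refine ⟨n, c, fun x => Submodule.pi Set.univ fun k => span K {w k x},
    Pi.single k₀ (∑ x ∈ X₀, w k₀ x), fun X => ?_, fun X => ?_⟩
  · rw [sup_pi_span_singleton, finrank_pi_submodule, hc]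
    simp_rw [hw]
  · have hli : LinearIndependent K (w k₀) := by
      rw [linearIndependent_iff_card_eq_finrank_span]
      have := hw k₀ Finset.univ
      rw [Finset.coe_univ, Set.image_univ, Finset.card_univ, min_eq_left hk₀.ge] at this
      exact this.symm
    rw [sup_pi_span_singleton]
    constructor
    · intro h x hx
      by_contra hxX
      -- Cancelling the terms with `y ≠ x` would put `w k₀ x` in the span of the other vectors,
      -- against independence.
      have h1 : ∑ y ∈ X₀, w k₀ y ∈ span K (w k₀ '' {x}ᶜ) := by
        have := h k₀ (Set.mem_univ _)
        rw [Pi.single_eq_same] at this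
        refine span_mono (Set.image_mono ?_) this
        rintro y hy rfl
        exact hxX hy
      have h2 : ∑ y ∈ X₀.erase x, w k₀ y ∈ span K (w k₀ '' {x}ᶜ) :=
        Submodule.sum_mem _ fun y hy =>
          subset_span (Set.mem_image_of_mem _ (Finset.ne_of_mem_erase hy))
      rw [← Finset.add_sum_erase _ _ hx] at h1
      exact hli.notMem_span_image (s := {x}ᶜ) (by simp)
        ((Submodule.add_mem_iff_left _ h2).1 h1)
    · intro h k _
      by_cases hk : k = k₀
      · subst hk
        rw [Pi.single_eq_same]
        exact Submodule.sum_mem _ fun x hx => subset_span (Set.mem_image_of_mem _ (h hx))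
      · rw [Pi.single_eq_of_ne hk]
        exact Submodule.zero_mem _

theorem isCompatible_principal (hQ : Q.IsUniform) (hη : Q.eta = Fintype.card J)
    {X₀ : Finset J} (hX₀ : X₀.Nonempty) : Q.IsCompatible {X | X₀ ⊆ X} := by
  refine ⟨fun X Y h hX => hX.trans h, ?_, fun Z W hZW => ?_, fun Z W => ?_⟩
  · simpa [Finset.subset_empty] using hX₀.ne_empty
  · have hsub : Finset.eraseNone Z ⊆ Finset.eraseNone W := Finset.eraseNone.monotone hZW
    have hle := Q.rank_mono _ _ hsub
    have hnone : none ∈ Z → none ∈ W := fun h => hZW h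
    unfold extensionRank
    simp only [Set.mem_ofPred_eq]
    -- Only here can the extra unit be lost, and the strict growth of the rank makes up for it.
    by_cases h : X₀ ⊆ Finset.eraseNone W ∧ ¬ X₀ ⊆ Finset.eraseNone Z
    · have hlt := rank_lt_rank hQ hη (hsub.ssubset_of_ne fun he => h.2 (he ▸ h.1))
      split_ifs <;> omega
    · split_ifs <;> first | omega | tauto
  · have h1 : Finset.eraseNone (Z ∩ W) = Finset.eraseNone Z ∩ Finset.eraseNone W := by
      ext x; simp
    have h2 : Finset.eraseNone (Z ∪ W) = Finset.eraseNone Z ∪ Finset.eraseNone W := by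
      ext x; simp
    have hs := Q.rank_submodular (Finset.eraseNone Z) (Finset.eraseNone W)
    have hl : X₀ ⊆ Finset.eraseNone Z → X₀ ⊆ Finset.eraseNone Z ∪ Finset.eraseNone W :=
      fun h => h.trans Finset.subset_union_left
    have hr : X₀ ⊆ Finset.eraseNone W → X₀ ⊆ Finset.eraseNone Z ∪ Finset.eraseNone W :=
      fun h => h.trans Finset.subset_union_right
    unfold extensionRank
    simp only [Set.mem_ofPred_eq, h1, h2, Finset.mem_inter, Finset.mem_union,
      Finset.subset_inter_iff]
    by_cases a : none ∈ Z <;> by_cases b : none ∈ W <;>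
      by_cases a' : X₀ ⊆ Finset.eraseNone Z <;> by_cases b' : X₀ ⊆ Finset.eraseNone W <;>
      simp only [a, b, a', b', hl, hr, true_and, false_and, and_true, and_false, or_true,
        or_false, not_true_eq_false, not_false_eq_true, if_true, if_false] <;>
      first | omega | (split_ifs <;> omega)

end Polymatroid


/-! ### Participants, their vectors and their blocks. -/

section

variable {P J K V : Type*} [Field K] [AddCommGroup V] [Module K V]

theorem span_image_le_sup {W : J → Submodule K V} {f : P → J} {v : P → V}
    (hv : ∀ p, v p ∈ W (f p)) {A : Finset P} {X : Finset J} (h : ∀ p ∈ A, f p ∈ X) :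
    span K (v '' A) ≤ X.sup W := by
  rw [span_le]
  rintro _ ⟨p, hp, rfl⟩
  exact Finset.le_sup (f := W) (h p hp) (hv p)

theorem finrank_span_image_eq_card {v : P → V} {A : Finset P}
    (h : LinearIndepOn K v (A : Set P)) : finrank K (span K (v '' A)) = A.card := by
  have := finrank_span_eq_card (R := K) (b := fun p : (A : Set P) => v p) h
  rw [← Set.image_eq_range] at this
  simpa using this

end

namespace Partition

variable {P J : Type*} (B : Partition P J)

theorem exists_index : ∃ f : P → J, ∀ p x, p ∈ B.block x ↔ f p = x := by
  choose f hf using B.cover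
  refine ⟨f, fun p x => ⟨fun h => ?_, fun h => h ▸ hf p⟩⟩
  by_contra hne
  exact Finset.disjoint_left.1 (B.disjoint _ _ hne) (hf p) h

theorem sum_vec [DecidableEq P] [DecidableEq J] {f : P → J}
    (hf : ∀ p x, p ∈ B.block x ↔ f p = x)
    (A : Finset P) (Y : Finset J) :
    ∑ y ∈ Y, B.vec A y = (A.filter fun p => f p ∈ Y).card := by
  have hmaps : Set.MapsTo f (A.filter fun p => f p ∈ Y : Finset P) Y :=
    fun p hp => (Finset.mem_filter.1 hp).2
  rw [Finset.card_eq_sum_card_fiberwise hmaps]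
  refine Finset.sum_congr rfl fun y hy => ?_
  unfold vec
  congr 1
  ext p
  simp only [Finset.mem_inter, Finset.mem_filter, hf]
  constructor
  · rintro ⟨h, rfl⟩
    exact ⟨⟨h, hy⟩, rfl⟩
  · rintro ⟨⟨h, -⟩, h'⟩
    exact ⟨h, h'⟩

theorem vec_mono [DecidableEq P] {A A' : Finset P} (h : A ⊆ A') :
    B.vec A ≤ B.vec A' :=
  fun _ => Finset.card_le_card (Finset.inter_subset_inter_right h)

theorem exists_subset_vec_eq [DecidableEq P] [Fintype J] {A : Finset P}
    {u : J → ℕ} (hu : u ≤ B.vec A) : ∃ A' ⊆ A, B.vec A' = u := by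
  choose s hs hcard using fun x => Finset.exists_subset_card_eq (hu x)
  have hsub : Finset.univ.biUnion s ⊆ A :=
    Finset.biUnion_subset.2 fun x _ => (hs x).trans Finset.inter_subset_left
  refine ⟨Finset.univ.biUnion s, hsub, funext fun x => ?_⟩
  rw [← hcard x]
  unfold vec
  congr 1
  ext p
  simp only [Finset.mem_inter, Finset.mem_biUnion, Finset.mem_univ, true_and]
  constructor
  · rintro ⟨⟨y, hy⟩, hx⟩
    by_cases hyx : y = x
    · exact hyx ▸ hy
    · exact absurd hx (Finset.disjoint_left.1 (B.disjoint y x hyx)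
        (Finset.mem_inter.1 (hs y hy)).2)
  · exact fun h => ⟨⟨x, h⟩, (Finset.mem_inter.1 (hs x h)).2⟩

end Partition

/-! ### Authorized sets as sets spanning `e`. -/

section

variable {P J : Type*} [Fintype P] [DecidableEq P] [DecidableEq J]

variable {K V : Type*} [Field K] [AddCommGroup V] [Module K V]

/-- `h({x}) ≤ |P_x|` lets each block span its `W x`; this makes the set of all participants
authorized. -/
theorem sup_le_span_univ [FiniteDimensional K V] (B : Partition P J) (Q : Polymatroid J)
    (hB : ∀ x, Q.rank {x} ≤ (B.block x).card) {W : J → Submodule K V}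
    (hW : ∀ X : Finset J, finrank K (X.sup W : Submodule K V) = Q.rank X)
    {f : P → J} (hf : ∀ p x, p ∈ B.block x ↔ f p = x)
    {v : P → V} (hv : ∀ p, v p ∈ W (f p))
    (hr : ∀ A : Finset P, ∃ C ⊆ A, finrank K (span K (v '' A)) =
      (A \ C).card + finrank K ((C.image f).sup W : Submodule K V)) (X : Finset J) :
    X.sup W ≤ span K (v '' (Finset.univ : Finset P)) := by
  refine Finset.sup_le fun x _ => ?_
  have hblock : ∀ p ∈ B.block x, f p ∈ ({x} : Finset J) := fun p hp =>
    Finset.mem_singleton.2 ((hf p x).1 hp)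
  have hrank : Q.rank {x} ≤ finrank K (span K (v '' (B.block x))) := by
    obtain ⟨C, hC, h⟩ := hr (B.block x)
    rcases C.eq_empty_or_nonempty with rfl | ⟨p, hp⟩
    · rw [h, Finset.sdiff_empty]
      exact (hB x).trans (Nat.le_add_right _ _)
    · have hx : {x} ⊆ C.image f := Finset.singleton_subset_iff.2
        (Finset.mem_image.2 ⟨p, hp, (hf p x).1 (hC hp)⟩)
      rw [h, hW]
      exact (Q.rank_mono _ _ hx).trans (Nat.le_add_left _ _)
  have heq : span K (v '' (B.block x)) = ({x} : Finset J).sup W :=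
    Submodule.eq_of_le_of_finrank_le (span_image_le_sup hv hblock) (by rwa [hW])
  rw [Finset.sup_singleton] at heq
  rw [← heq]
  exact span_mono (Set.image_mono (Finset.coe_subset.2 (Finset.subset_univ _)))

variable [Fintype J]

/-- Minimality can be dropped, since every vector of the union lies above a minimal one. -/
theorem mem_determinedStructure (B : Partition P J) (Q : Polymatroid J) (Δ : Set (Finset J))
    (A : Finset P) : A ∈ determinedStructure B Q Δ ↔
      ∃ X ∈ Δ, ∃ u ∈ Q.bases X, u ≤ B.vec A := by
  constructor
  · rintro ⟨-, u, hu, hle⟩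
    obtain ⟨X, hX, huX⟩ := Set.mem_iUnion₂.1 hu.prop
    exact ⟨X, hX, u, huX, hle⟩
  · rintro ⟨X, hX, u, hu, hle⟩
    obtain ⟨u', hu', hmin⟩ := exists_minimal_le_of_wellFoundedLT
      (· ∈ ⋃ X ∈ Δ, Q.bases X) u (Set.mem_iUnion₂.2 ⟨X, hX, hu⟩)
    exact ⟨B.vec_mono (Finset.subset_univ A), u', hmin, hu'.trans hle⟩

/-- Generic vectors in the subspaces `W (f p)`, also with respect to a further vector `e`. -/
theorem exists_generic_vectors_with_point [Finite K] [FiniteDimensional K V]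
    (hK : 2 ^ (Fintype.card P + Fintype.card J + 1) < Nat.card K)
    (W : J → Submodule K V) (e : V) (f : P → J) :
    ∃ v : P → V, (∀ p, v p ∈ W (f p)) ∧
      (∀ A : Finset P, ∃ C ⊆ A, finrank K (span K (v '' A)) =
        (A \ C).card + finrank K ((C.image f).sup W : Submodule K V)) ∧
      ∀ A : Finset P, ∃ C ⊆ A, finrank K (span K (v '' A) ⊔ span K {e} : Submodule K V) =
        (A \ C).card + finrank K ((C.image f).sup W ⊔ span K {e} : Submodule K V) := by
  -- The line `K e` is an extra subspace with index `none`; `Y = ∅` and `Y = {none}` give the two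
  -- formulas.
  obtain ⟨v, hv, hr⟩ := exists_generic_vectors (K := K) (V := V) (P := P) (ι := Option J)
    (by rwa [Fintype.card_option, ← add_assoc])
    (fun x => x.elim (span K {e}) W) (fun p => some (f p))
  have himage : ∀ C : Finset P, (C.image fun p => some (f p)).sup
      (fun x : Option J => x.elim (span K {e}) W) = (C.image f).sup W := by
    intro C
    rw [Finset.sup_image, Finset.sup_image]
    rfl
  refine ⟨v, hv, fun A => ?_, fun A => ?_⟩
  · obtain ⟨C, hC, h⟩ := hr A ∅
    refine ⟨C, hC, ?_⟩
    rwa [Finset.sup_empty, sup_bot_eq, Finset.empty_union, himage] at h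
  · obtain ⟨C, hC, h⟩ := hr A {none}
    refine ⟨C, hC, ?_⟩
    rwa [Finset.sup_union, Finset.sup_singleton, himage, sup_comm (Option.elim _ _ _)] at h

theorem mem_determinedStructure_iff_mem_span [FiniteDimensional K V]
    (B : Partition P J) (Q : Polymatroid J) {X₀ : Finset J}
    {W : J → Submodule K V} {e : V}
    (hW : ∀ X : Finset J, finrank K (X.sup W : Submodule K V) = Q.rank X)
    (he : ∀ X : Finset J, e ∈ X.sup W ↔ X₀ ⊆ X)
    {f : P → J} (hf : ∀ p x, p ∈ B.block x ↔ f p = x)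
    {v : P → V} (hv : ∀ p, v p ∈ W (f p))
    (hr : ∀ A : Finset P, ∃ C ⊆ A, finrank K (span K (v '' A)) =
      (A \ C).card + finrank K ((C.image f).sup W : Submodule K V))
    (hre : ∀ A : Finset P, ∃ C ⊆ A, finrank K (span K (v '' A) ⊔ span K {e} : Submodule K V) =
      (A \ C).card + finrank K ((C.image f).sup W ⊔ span K {e} : Submodule K V))
    (A : Finset P) :
    A ∈ determinedStructure B Q {X | X₀ ⊆ X} ↔ e ∈ span K (v '' A) := by
  classical
  rw [mem_determinedStructure]
  constructor
  · rintro ⟨X, hX, u, ⟨hsupp, hsum, hbound⟩, hle⟩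
    obtain ⟨A', hA', rfl⟩ := B.exists_subset_vec_eq hle
    have hAX : ∀ p ∈ A', f p ∈ X := by
      intro p hp
      apply hsupp
      exact (Finset.card_pos.2 ⟨p, Finset.mem_inter.2 ⟨hp, (hf p _).2 rfl⟩⟩).ne'
    have hcard : A'.card = Q.rank X := by
      rw [← hsum, B.sum_vec hf]
      simp
    obtain ⟨C, hC, hrank⟩ := hr A'
    have hCX : C.image f ⊆ X := Finset.image_subset_iff.2 fun p hp => hAX p (hC hp)
    -- Hence the rank formula gives dimension at least `|A' \ C| + |C| = h(X)`, so `A'` spans all of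
    -- `X.sup W`.
    have hCle : C.card ≤ Q.rank (C.image f) := by
      refine le_trans (Finset.card_le_card fun p hp => ?_)
        ((B.sum_vec hf A' (C.image f)).symm.trans_le (hbound _ hCX))
      exact Finset.mem_filter.2 ⟨hC hp, Finset.mem_image_of_mem f hp⟩
    have hsd := Finset.card_sdiff_add_card_eq_card hC
    rw [hW] at hrank
    have heq : span K (v '' A') = X.sup W := by
      apply Submodule.eq_of_le_of_finrank_le (span_image_le_sup hv hAX)
      rw [hW]
      omega
    have hmem : e ∈ span K (v '' A') := by
      rw [heq]
      exact (he X).2 hX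
    exact span_mono (Set.image_mono (Finset.coe_subset.2 hA')) hmem
  · intro hmem
    obtain ⟨C, hC, hrank⟩ := hre A
    rw [sup_eq_left.2 ((span_singleton_le_iff_mem e _).2 hmem)] at hrank
    have hCspan : span K (v '' C) ≤ (C.image f).sup W :=
      span_image_le_sup hv fun p hp => Finset.mem_image_of_mem f hp
    have hAle : finrank K (span K (v '' A)) ≤ (A \ C).card + finrank K (span K (v '' C)) := by
      have h1 : span K (v '' A) = span K (v '' (A \ C : Finset P)) ⊔ span K (v '' C) := by
        rw [← span_union, ← Set.image_union, ← Finset.coe_union, Finset.sdiff_union_of_subset hC]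
      have h2 : finrank K (span K (v '' (A \ C : Finset P))) ≤ (A \ C).card := by
        rw [← Finset.coe_image]
        exact (finrank_span_finset_le_card _).trans Finset.card_image_le
      rw [h1]
      exact (Submodule.finrank_add_le_finrank_add_finrank _ _).trans (by omega)
    have hle1 := Submodule.finrank_mono hCspan
    have hle2 := Submodule.finrank_mono
      (le_sup_left : (C.image f).sup W ≤ (C.image f).sup W ⊔ span K {e})
    -- The bounds squeeze `span (v C) ≤ W_{f(C)} ≤ W_{f(C)} + K e` into equalities. So `X₀ ⊆ f(C)`,
    -- and a basis `D` chosen from the vectors of `C` has its profile in `𝓑(Q, f(C))`.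
    have heq : span K (v '' C) = (C.image f).sup W :=
      Submodule.eq_of_le_of_finrank_le hCspan (by omega)
    have heX : X₀ ⊆ C.image f := by
      rw [← he, Submodule.eq_of_le_of_finrank_le le_sup_left
        (show finrank K ((C.image f).sup W ⊔ span K {e} : Submodule K V) ≤ _ by omega)]
      exact mem_sup_right (mem_span_singleton_self e)
    obtain ⟨D, hDC, -, hDspan, hDli⟩ := exists_linearIndepOn_extension
      (K := K) (v := v) (linearIndepOn_empty K v) (Set.empty_subset (C : Set P))
    lift D to Finset P using Set.toFinite D
    have hDeq : span K (v '' D) = (C.image f).sup W :=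
      le_antisymm ((span_mono (Set.image_mono hDC)).trans hCspan)
        (heq ▸ span_le.2 hDspan)
    have hDC' : D ⊆ C := Finset.coe_subset.1 hDC
    refine ⟨C.image f, heX, B.vec D, ⟨fun x hx => ?_, ?_, fun Y _ => ?_⟩,
      B.vec_mono (hDC'.trans hC)⟩
    · obtain ⟨p, hp⟩ := Finset.card_pos.1 (Nat.pos_of_ne_zero hx)
      obtain ⟨hpD, hpx⟩ := Finset.mem_inter.1 hp
      exact (hf p x).1 hpx ▸ Finset.mem_image_of_mem f (hDC' hpD)
    · rw [B.sum_vec hf, ← hW, ← hDeq, finrank_span_image_eq_card hDli]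
      simp
    · rw [B.sum_vec hf, ← hW, ← finrank_span_image_eq_card (K := K) (v := v)
        (hDli.mono (Finset.coe_subset.2 (Finset.filter_subset _ _)))]
      exact Submodule.finrank_mono
        (span_image_le_sup hv fun p hp => (Finset.mem_filter.1 hp).2)

theorem isIdealAccessStructure_principal (B : Partition P J) (Q : Polymatroid J)
    (hQ : Q.IsUniform) (hη : Q.eta = Fintype.card J)
    (hB : ∀ x, Q.rank {x} ≤ (B.block x).card) {X₀ : Finset J} (hX₀ : X₀.Nonempty) :
    IsIdealAccessStructure (determinedStructure B Q {X | X₀ ⊆ X}) := by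
  have : Nonempty J := ⟨hX₀.choose⟩
  obtain ⟨q, hqle, hq⟩ := Nat.exists_infinite_primes
    (2 ^ (Fintype.card P + Fintype.card J + 1) + 1)
  have : Fact q.Prime := ⟨hq⟩
  have hK : 2 ^ (Fintype.card P + Fintype.card J + 1) < Nat.card (ZMod q) := by
    rw [Nat.card_zmod]
    omega
  have hK' : 2 ^ (Fintype.card J + 1) < Nat.card (ZMod q) :=
    lt_of_le_of_lt (Nat.pow_le_pow_right two_pos (by omega)) hK
  obtain ⟨n, c, W, e, hW, he⟩ := Polymatroid.exists_representation hQ hη X₀ hK'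
  obtain ⟨f, hf⟩ := B.exists_index
  obtain ⟨v, hv, hr, hre⟩ := exists_generic_vectors_with_point hK W e f
  have hmem := mem_determinedStructure_iff_mem_span B Q hW he hf hv hr hre
  have hpos : ∀ X : Finset J, X.Nonempty → 0 < Q.rank X := fun X hX =>
    Q.rank_empty ▸ Polymatroid.rank_lt_rank hQ hη (Finset.empty_ssubset.2 hX)
  have he0 : e ≠ 0 := by
    rintro rfl
    exact hX₀.ne_empty (Finset.subset_empty.1 ((he ∅).1 (Submodule.zero_mem _)))
  -- For `A = {p}` both terms of the rank formula cannot vanish: `C = ∅` contributes 1, and `C =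
  -- {p}` a positive rank.
  have hv0 : ∀ p, v p ≠ 0 := by
    intro p hp
    obtain ⟨C, hC, h⟩ := hr {p}
    rw [Finset.coe_singleton, Set.image_singleton, hp, span_zero_singleton, finrank_bot, hW] at h
    rcases C.eq_empty_or_nonempty with rfl | hne
    · simp at h
      omega
    · have := hpos _ (hne.image f)
      omega
  have hset : determinedStructure B Q {X | X₀ ⊆ X} =
      {A : Finset P | e ∈ span (ZMod q) (v '' A)} := Set.ext hmem
  refine ⟨⟨fun A A' h hA => ?_, fun h => ?_, ?_⟩, ?_⟩
  · rw [hmem] at hA ⊢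
    exact span_mono (Set.image_mono (Finset.coe_subset.2 h)) hA
  · rw [hmem] at h
    simp [he0] at h
  · rw [hmem]
    exact sup_le_span_univ B Q hB hW hf hv hr X₀ ((he X₀).2 subset_rfl)
  · rw [hset]
    exact exists_ideal_scheme_of_vectors he0 v hv0

end

/-! ### Reduction to principal families and conclusion. -/

/-- A monotone family with exactly one minimal set that is not the family of all sets consists of
the sets that contain some nonempty set. -/
theorem exists_eq_principal {J : Type*} [Fintype J] {Δ : Set (Finset J)}
    (hΔ : IsUpperSet Δ) (hΔ' : Δ ≠ Set.univ) (hmin : (minimals Δ).ncard = 1) :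
    ∃ X₀ : Finset J, X₀.Nonempty ∧ Δ = {X | X₀ ⊆ X} := by
  obtain ⟨X₀, hX₀⟩ := Set.ncard_eq_one.1 hmin
  have hX₀' : X₀ ∈ minimals Δ := hX₀ ▸ Set.mem_singleton X₀
  have heq : Δ = {X | X₀ ⊆ X} := by
    ext X
    refine ⟨fun hX => ?_, fun h => hΔ h hX₀'.prop⟩
    obtain ⟨Y, hYX, hY⟩ := exists_minimal_le_of_wellFoundedLT (· ∈ Δ) X hX
    have : Y ∈ ({X₀} : Set (Finset J)) := hX₀ ▸ hY
    rw [Set.mem_singleton_iff] at this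
    exact this ▸ hYX
  refine ⟨X₀, Finset.nonempty_iff_ne_empty.2 fun h => hΔ' ?_, heq⟩
  rw [heq, h]
  ext X
  simp

end SecretSharing

theorem mainTheorem11 {P J : Type*} [Fintype P] [DecidableEq P] [Fintype J] [DecidableEq J]
    (B : SecretSharing.Partition P J)
    (Q : SecretSharing.Polymatroid J) (hQ : Q.IsUniform)
    (hη : Q.eta = Fintype.card J)
    (hB : ∀ x, Q.rank {x} ≤ (B.block x).card)
    (Δ : Set (Finset J)) (hΔ : IsUpperSet Δ) (hΔ' : Δ ≠ Set.univ)
    (hmin : (SecretSharing.minimals Δ).ncard = 1) :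
    Q.IsCompatible Δ ∧
      SecretSharing.IsIdealAccessStructure (SecretSharing.determinedStructure B Q Δ) := by
  obtain ⟨X₀, hne, rfl⟩ := SecretSharing.exists_eq_principal hΔ hΔ' hmin
  exact ⟨SecretSharing.Polymatroid.isCompatible_principal hQ hη hne,
    SecretSharing.isIdealAccessStructure_principal B Q hQ hη hB hne⟩
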